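/- For a group $\mathbf G$ with underlying set $G$, the power graph $\mathcal G(\mathbf G)$ is the simple graph with vertex set $G$ in which two distinct elements $x,y$ are adjacent if and only if there exists $n\in\mathbb Z\setminus\{0\}$ such that $y=x^n$ or $x=y^n$. The enhanced power graph $\mathcal G_e(\mathbf G)$ is the simple graph with vertex set $G$ in which two distinct elements $x,y$ are adjacent if and only if there exist $z\in G$ and $n,m\in\mathbb Z$ such that $x=z^n$ and $y=z^m$. Theorem. Let $\mathbf G$ and $\mathbf H$ be arbitrary (not necessarily finite) groups whose power graphs $\mathcal G(\mathbf G)$ and $\mathcal G(\mathbf H)$ are isomorphic. Then their enhanced power graphs $\mathcal G_e(\mathbf G)$ and $\mathcal G_e(\mathbf H)$ are isomorphic too. -/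

import Mathlib

/-- The power graph of a group `G`: its vertices are the elements of `G`, and distinct `x` and `y`
are adjacent if one of them is a power of the other with a nonzero integer exponent. -/
def powerGraph (G : Type*) [Group G] : SimpleGraph G where
  Adj x y := x ≠ y ∧ ∃ n : ℤ, n ≠ 0 ∧ (y = x ^ n ∨ x = y ^ n)
  symm := ⟨fun _ _ ⟨hne, n, hn, h⟩ => ⟨hne.symm, n, hn, h.symm⟩⟩
  loopless := ⟨fun _ h => h.1 rfl⟩

/-- The enhanced power graph of a group `G`: its vertices are the elements of `G`, and distinct `x`
and `y` are adjacent if both are powers of some element of `G`. -/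
def enhancedPowerGraph (G : Type*) [Group G] : SimpleGraph G where
  Adj x y := x ≠ y ∧ ∃ z : G, ∃ n m : ℤ, x = z ^ n ∧ y = z ^ m
  symm := ⟨fun _ _ ⟨hne, z, n, m, hx, hy⟩ => ⟨hne.symm, z, m, n, hy, hx⟩⟩
  loopless := ⟨fun _ h => h.1 rfl⟩

/-!
The power graph determines the enhanced power graph because a comparability-preserving bijection
`φ : G ≃ H` (`x` and `y` being comparable if one is a nonzero power of the other) already preserves
the existence of a common root, except possibly between the identity and elements of infinite order.

Torsion elements are comparable to torsion elements only, and they form the neighbourhood of the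
identity. `φ` maps torsion elements to torsion elements (`isOfFinOrder_map_iff`): if `φ 1` had
infinite order, then `1` would have a nontrivial twin, that is, an element with the same closed
neighbourhood. This makes the torsion elements of `G` a finite cyclic group or a union of cyclic
`p`-groups (`PowTwin.one_cases`), neither of which fits the neighbourhood of `φ 1`.

*Infinite order.* For `z` of infinite order, `φ` maps all proper powers of `z` to powers of `φ z`,
or all of them to roots of `φ z`
(`forall_isNonzeroPow_or_forall_isNonzeroPow`). In the first case elements with common root `z` are
mapped to elements with common root `φ z`. In the second case the order is also reversed at the
powers of `z` (`isNonzeroPow_of_forall_isNonzeroPow`), and a common power of two powers of `z`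
becomes a common root of their images.

*Torsion.* If `x` and `y` are incomparable powers of a torsion element `z` and `φ z` is not a common
root of their images, then the order is reversed at `z`, and there are `u`, `v` in `zpowers z` of
coprime orders `M`, `K` with `M * K = orderOf z` whose images are incomparable roots of `φ z`.
Counting twins rules this out (`false_of_isNonzeroPow_map`): `z` has at least
`totient (M * K) = totient M * totient K` twins, `u` and `v` have at most `totient M` and
`totient K`, while the twins of `φ z`
lie in `zpowers (φ u)` and `zpowers (φ v)`, which leaves too little room for them. The count
requires some care if the identity of `H` has nontrivial twins.

Finally, `φ 1` and `1` have common roots with all torsion elements, so composing `φ` with the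
transposition of `φ 1` and `1` does no harm, and makes the identity correspond to the identity.
-/

/-! ### Nonzero powers, comparability and twins -/

/-- `y` is a power of `x` with a nonzero integer exponent. -/
def IsNonzeroPow {G : Type*} [Group G] (x y : G) : Prop := ∃ n : ℤ, n ≠ 0 ∧ y = x ^ n

/-- The reflexive closure of adjacency in the power graph. -/
def PowComparable {G : Type*} [Group G] (x y : G) : Prop := IsNonzeroPow x y ∨ IsNonzeroPow y x

/-- `x` and `y` have the same closed neighbourhood in the power graph. -/
def PowTwin {G : Type*} [Group G] (x y : G) : Prop :=
  ∀ w, PowComparable w x ↔ PowComparable w y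

/-- The reflexive closure of adjacency in the enhanced power graph. -/
def HaveCommonRoot {G : Type*} [Group G] (x y : G) : Prop :=
  ∃ z : G, x ∈ Subgroup.zpowers z ∧ y ∈ Subgroup.zpowers z

section Basic

variable {G H : Type*} [Group G] [Group H]

lemma IsNonzeroPow.refl (x : G) : IsNonzeroPow x x := ⟨1, one_ne_zero, by simp⟩

lemma IsNonzeroPow.trans {x y z : G} (hxy : IsNonzeroPow x y) (hyz : IsNonzeroPow y z) :
    IsNonzeroPow x z := by
  obtain ⟨n, hn, rfl⟩ := hxy
  obtain ⟨m, hm, rfl⟩ := hyz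
  exact ⟨n * m, mul_ne_zero hn hm, by rw [zpow_mul]⟩

lemma IsNonzeroPow.mem_zpowers {x y : G} (h : IsNonzeroPow x y) : y ∈ Subgroup.zpowers x := by
  obtain ⟨n, -, rfl⟩ := h
  exact Subgroup.zpow_mem_zpowers x n

lemma isNonzeroPow_zpow (x : G) {n : ℤ} (hn : n ≠ 0) : IsNonzeroPow x (x ^ n) := ⟨n, hn, rfl⟩

/-- Below a torsion element the exponent may be taken nonzero, being only relevant modulo the
order. -/
lemma IsOfFinOrder.isNonzeroPow_iff {x y : G} (hx : IsOfFinOrder x) :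
    IsNonzeroPow x y ↔ y ∈ Subgroup.zpowers x := by
  refine ⟨IsNonzeroPow.mem_zpowers, ?_⟩
  rintro ⟨n, rfl⟩
  by_cases hn : n = 0
  · refine ⟨orderOf x, by exact_mod_cast hx.orderOf_pos.ne', ?_⟩
    simp [hn, pow_orderOf_eq_one]
  · exact ⟨n, hn, rfl⟩

lemma IsNonzeroPow.isOfFinOrder_iff {x y : G} (h : IsNonzeroPow x y) :
    IsOfFinOrder y ↔ IsOfFinOrder x := by
  obtain ⟨n, hn, rfl⟩ := h
  refine ⟨fun hf => ?_, fun hf => hf.zpow⟩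
  obtain ⟨m, hm, h1⟩ := isOfFinOrder_iff_zpow_eq_one.1 hf
  exact isOfFinOrder_iff_zpow_eq_one.2 ⟨n * m, mul_ne_zero hn hm, by rw [zpow_mul, h1]⟩

lemma PowComparable.refl (x : G) : PowComparable x x := Or.inl (.refl x)

lemma PowComparable.symm {x y : G} (h : PowComparable x y) : PowComparable y x := Or.symm h

lemma PowComparable.isOfFinOrder_iff {x y : G} (h : PowComparable x y) :
    IsOfFinOrder x ↔ IsOfFinOrder y := by
  rcases h with h | h
  · exact h.isOfFinOrder_iff.symm
  · exact h.isOfFinOrder_iff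

lemma PowComparable.haveCommonRoot {x y : G} (h : PowComparable x y) : HaveCommonRoot x y := by
  rcases h with h | h
  · exact ⟨x, Subgroup.mem_zpowers x, h.mem_zpowers⟩
  · exact ⟨y, h.mem_zpowers, Subgroup.mem_zpowers y⟩

lemma powComparable_one_iff {x : G} : PowComparable x 1 ↔ IsOfFinOrder x := by
  refine ⟨fun h => h.isOfFinOrder_iff.2 IsOfFinOrder.one, fun h => Or.inl ?_⟩
  exact h.isNonzeroPow_iff.2 (one_mem _)

lemma HaveCommonRoot.symm {x y : G} (h : HaveCommonRoot x y) : HaveCommonRoot y x := by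
  obtain ⟨z, hx, hy⟩ := h
  exact ⟨z, hy, hx⟩

lemma haveCommonRoot_one_left (x : G) : HaveCommonRoot 1 x :=
  ⟨x, one_mem _, Subgroup.mem_zpowers x⟩

lemma isOfFinOrder_of_mem_zpowers {x z : G} (hz : IsOfFinOrder z) (hx : x ∈ Subgroup.zpowers z) :
    IsOfFinOrder x := (hz.isNonzeroPow_iff.2 hx).isOfFinOrder_iff.2 hz

/-- A torsion element and an element of infinite order have a common root only if the former is
the identity. -/
lemma HaveCommonRoot.eq_one {x y : G} (h : HaveCommonRoot x y) (hx : IsOfFinOrder x)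
    (hy : ¬ IsOfFinOrder y) : x = 1 := by
  obtain ⟨z, ⟨n, rfl⟩, hyz⟩ := h
  have hz : ¬ IsOfFinOrder z := fun hz => hy (isOfFinOrder_of_mem_zpowers hz hyz)
  by_cases hn : n = 0
  · simp [hn]
  · exact absurd ((isNonzeroPow_zpow z hn).isOfFinOrder_iff.1 hx) hz

lemma PowTwin.refl (x : G) : PowTwin x x := fun _ => Iff.rfl

lemma PowTwin.symm {x y : G} (h : PowTwin x y) : PowTwin y x := fun w => (h w).symm

lemma PowTwin.trans {x y z : G} (h : PowTwin x y) (h' : PowTwin y z) : PowTwin x z :=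
  fun w => (h w).trans (h' w)

lemma PowTwin.powComparable {x y : G} (h : PowTwin x y) : PowComparable x y :=
  (h x).1 (.refl x)

lemma powTwin_of_isNonzeroPow {x y : G} (h : IsNonzeroPow x y) (h' : IsNonzeroPow y x) :
    PowTwin x y := by
  intro w
  constructor
  · rintro (hw | hw)
    · exact Or.inl (hw.trans h)
    · exact Or.inr (h'.trans hw)
  · rintro (hw | hw)
    · exact Or.inl (hw.trans h')
    · exact Or.inr (h.trans hw)

lemma powTwin_inv (x : G) : PowTwin x x⁻¹ :=
  powTwin_of_isNonzeroPow ⟨-1, by simp, by simp⟩ ⟨-1, by simp, by simp⟩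

lemma powTwin_map_iff (φ : G ≃ H) (hφ : ∀ x y, PowComparable (φ x) (φ y) ↔ PowComparable x y)
    {x y : G} : PowTwin (φ x) (φ y) ↔ PowTwin x y := by
  constructor
  · intro h w
    rw [← hφ, ← hφ]
    exact h _
  · intro h w
    obtain ⟨w, rfl⟩ := φ.surjective w
    rw [hφ, hφ]
    exact h _

lemma powComparable_symm_apply_iff (φ : G ≃ H)
    (hφ : ∀ x y, PowComparable (φ x) (φ y) ↔ PowComparable x y) (x y : H) :
    PowComparable (φ.symm x) (φ.symm y) ↔ PowComparable x y := by
  rw [← hφ]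
  simp

end Basic

/-! ### Elements of infinite order -/

section Infinite

variable {G H : Type*} [Group G] [Group H]

lemma dvd_of_isNonzeroPow_zpow {z : G} (hz : ¬ IsOfFinOrder z) {n m : ℤ}
    (h : IsNonzeroPow (z ^ n) (z ^ m)) : n ∣ m := by
  obtain ⟨k, -, hk⟩ := h
  rw [← zpow_mul] at hk
  exact ⟨k, injective_zpow_iff_not_isOfFinOrder.2 hz hk⟩

lemma not_powComparable_zpow_of_isCoprime {z : G} (hz : ¬ IsOfFinOrder z) {n m : ℤ}
    (hn : 2 ≤ |n|) (hm : 2 ≤ |m|) (h : IsCoprime n m) : ¬ PowComparable (z ^ n) (z ^ m) := by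
  have key : ∀ a b : ℤ, 2 ≤ |a| → IsCoprime a b → ¬ a ∣ b := by
    intro a b ha hab hd
    have := Int.isUnit_iff_abs_eq.1 (hab.isUnit_of_dvd' dvd_rfl hd)
    omega
  rintro (h' | h')
  · exact key n m hn h (dvd_of_isNonzeroPow_zpow hz h')
  · exact key m n hm h.symm (dvd_of_isNonzeroPow_zpow hz h')

lemma zpow_inj_of_infinite {z : G} (hz : ¬ IsOfFinOrder z) {n m : ℤ} (h : z ^ n = z ^ m) :
    n = m := injective_zpow_iff_not_isOfFinOrder.2 hz h

/-- The proper powers of an element `z` of infinite order are mapped all to powers of `φ z` or all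
to roots of `φ z`: two coprime powers are not comparable, so their images lie on the same side of
`φ z`, and any two exponents have a third one coprime to both. -/
lemma forall_isNonzeroPow_or_forall_isNonzeroPow (φ : G ≃ H)
    (hφ : ∀ x y, PowComparable (φ x) (φ y) ↔ PowComparable x y) {z : G} (hz : ¬ IsOfFinOrder z) :
    (∀ n : ℤ, 2 ≤ |n| → IsNonzeroPow (φ z) (φ (z ^ n))) ∨
      (∀ n : ℤ, 2 ≤ |n| → IsNonzeroPow (φ (z ^ n)) (φ z)) := by
  by_contra! hcon
  obtain ⟨⟨n, hn, hn'⟩, m, hm, hm'⟩ := hcon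
  have hcmp : ∀ k : ℤ, 2 ≤ |k| → PowComparable (φ z) (φ (z ^ k)) := fun k hk =>
    (hφ _ _).2 (Or.inl (isNonzeroPow_zpow z (by rintro rfl; simp at hk)))
  have hnz := (hcmp n hn).resolve_left hn'
  have hmz := (hcmp m hm).resolve_right hm'
  have h4 : 4 ≤ |n * m| := by rw [abs_mul]; nlinarith
  have hk : 2 ≤ |n * m + 1| := by
    rcases le_abs.1 h4 with h | h
    · exact le_abs.2 (Or.inl (by omega))
    · exact le_abs.2 (Or.inr (by omega))
  have hkn : IsCoprime n (n * m + 1) := ⟨-m, 1, by ring⟩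
  have hkm : IsCoprime m (n * m + 1) := ⟨-n, 1, by ring⟩
  rcases hcmp _ hk with h | h
  · exact not_powComparable_zpow_of_isCoprime hz hn hk hkn ((hφ _ _).1 (Or.inl (hnz.trans h)))
  · exact not_powComparable_zpow_of_isCoprime hz hm hk hkm ((hφ _ _).1 (Or.inr (h.trans hmz)))

/-- If the order is reversed at `z`, then it is reversed at every proper power `x` of `z`:
otherwise the images of all powers of `x` would lie between `φ x` and its power `φ z`, where there
is room for finitely many elements only. -/
lemma isNonzeroPow_of_forall_isNonzeroPow (φ : G ≃ H)
    (hφ : ∀ x y, PowComparable (φ x) (φ y) ↔ PowComparable x y) {z : G} (hz : ¬ IsOfFinOrder z)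
    (h : ∀ n : ℤ, 2 ≤ |n| → IsNonzeroPow (φ (z ^ n)) (φ z)) {a : ℤ} (ha : 2 ≤ |a|) (n : ℤ)
    (hn : 2 ≤ |n|) (hinf : ¬ IsOfFinOrder (φ (z ^ a))) :
    IsNonzeroPow (φ ((z ^ a) ^ n)) (φ (z ^ a)) := by
  have ha0 : a ≠ 0 := by rintro rfl; simp at ha
  have hx : ¬ IsOfFinOrder (z ^ a) := by
    rwa [(isNonzeroPow_zpow z ha0).isOfFinOrder_iff]
  rcases forall_isNonzeroPow_or_forall_isNonzeroPow φ hφ hx with h' | h'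
  · exfalso
    obtain ⟨k, hk, hkz⟩ := h a ha
    have hfin : ((fun j : ℤ => φ (z ^ a) ^ j) '' Set.Icc (-|k|) |k|).Finite :=
      (Set.finite_Icc _ _).image _
    have hsub : (fun m : ℕ => φ ((z ^ a) ^ ((m : ℤ) + 2))) '' Set.univ ⊆
        (fun j : ℤ => φ (z ^ a) ^ j) '' Set.Icc (-|k|) |k| := by
      rintro _ ⟨m, -, rfl⟩
      have hm : (2 : ℤ) ≤ |(m : ℤ) + 2| := by rw [abs_of_nonneg] <;> omega
      obtain ⟨j, hj, hjx⟩ := h' (m + 2) hm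
      have ham : (2 : ℤ) ≤ |a * (m + 2)| := by rw [abs_mul]; nlinarith
      obtain ⟨i, hi, hiz⟩ := h _ ham
      rw [zpow_mul, hjx, ← zpow_mul, hkz] at hiz
      have hkji : k = j * i := zpow_inj_of_infinite hinf hiz
      refine ⟨j, ?_, hjx.symm⟩
      have hjk : |j| ≤ |k| := by
        rw [hkji, abs_mul]
        exact le_mul_of_one_le_right (abs_nonneg _) (Int.one_le_abs hi)
      exact abs_le.1 hjk
    have hinj : Function.Injective (fun m : ℕ => φ ((z ^ a) ^ ((m : ℤ) + 2))) := by
      intro m m' hmm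
      have := zpow_inj_of_infinite hx (φ.injective hmm)
      omega
    exact (Set.infinite_univ.image hinj.injOn) (hfin.subset hsub)
  · exact h' n hn

lemma haveCommonRoot_map_of_not_isOfFinOrder (φ : G ≃ H)
    (hφ : ∀ x y, PowComparable (φ x) (φ y) ↔ PowComparable x y)
    (hT : ∀ x, IsOfFinOrder (φ x) ↔ IsOfFinOrder x) {x y : G} (hx : ¬ IsOfFinOrder x)
    (hy : ¬ IsOfFinOrder y) (h : HaveCommonRoot x y) : HaveCommonRoot (φ x) (φ y) := by
  by_cases hxy : PowComparable x y
  · exact ((hφ _ _).2 hxy).haveCommonRoot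
  obtain ⟨z, ⟨a, rfl⟩, ⟨b, rfl⟩⟩ := h
  simp only at hx hy hxy ⊢
  have hz : ¬ IsOfFinOrder z := fun hz => hx hz.zpow
  have ha0 : a ≠ 0 := by rintro rfl; simp at hx
  have hb0 : b ≠ 0 := by rintro rfl; simp at hy
  -- A generator of `zpowers z` would be comparable to everything in `zpowers z`.
  have ha : 2 ≤ |a| := by
    by_contra hlt
    have h1 : |a| = 1 := by have := Int.one_le_abs ha0; omega
    obtain ⟨c, hc⟩ := (Int.isUnit_iff_abs_eq.2 h1).dvd (a := b)
    refine hxy (Or.inl ⟨c, ?_, by rw [hc, zpow_mul]⟩)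
    rintro rfl; simp at hc; exact hb0 hc
  have hb : 2 ≤ |b| := by
    by_contra hlt
    have h1 : |b| = 1 := by have := Int.one_le_abs hb0; omega
    obtain ⟨c, hc⟩ := (Int.isUnit_iff_abs_eq.2 h1).dvd (a := a)
    refine hxy (Or.inr ⟨c, ?_, by rw [hc, zpow_mul]⟩)
    rintro rfl; simp at hc; exact ha0 hc
  rcases forall_isNonzeroPow_or_forall_isNonzeroPow φ hφ hz with h | h
  · exact ⟨φ z, (h a ha).mem_zpowers, (h b hb).mem_zpowers⟩
  -- The order is reversed, so a common power becomes a common root.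
  · refine ⟨φ (z ^ (a * b)), ?_, ?_⟩
    · rw [zpow_mul]
      exact (isNonzeroPow_of_forall_isNonzeroPow φ hφ hz h ha b hb
        (by rwa [hT])).mem_zpowers
    · rw [mul_comm, zpow_mul]
      exact (isNonzeroPow_of_forall_isNonzeroPow φ hφ hz h hb a ha
        (by rwa [hT])).mem_zpowers

end Infinite

/-! ### Cyclic subgroups of finite order -/

section Cyclic

variable {G : Type*} [Group G]

/-- A divisor `d ≠ 1, N` of a number `N` which is not a prime power is incomparable, for
divisibility, to some `M` for which `N = M * K` is a coprime factorization. -/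
lemma exists_coprime_mul_eq_of_not_isPrimePow {N d : ℕ} (hN : N ≠ 0) (hpp : ¬ IsPrimePow N)
    (hdN : d ∣ N) (hd1 : d ≠ 1) (hd : d ≠ N) :
    ∃ M K : ℕ, M.Coprime K ∧ N = M * K ∧ ¬ M ∣ d ∧ ¬ d ∣ M := by
  have hNd : ¬ N ∣ d := fun h => hd (Nat.dvd_antisymm hdN h)
  rw [Nat.dvd_iff_prime_pow_dvd_dvd] at hNd
  push Not at hNd
  obtain ⟨p, k, hp, hk, hkd⟩ := hNd
  have hMd : ¬ p ^ N.factorization p ∣ d := fun h =>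
    hkd ((pow_dvd_pow p ((hp.pow_dvd_iff_le_factorization hN).1 hk)).trans h)
  have hcop : (p ^ N.factorization p).Coprime (N / p ^ N.factorization p) :=
    (Nat.coprime_ordCompl hp hN).pow_left _
  have hmul : p ^ N.factorization p * (N / p ^ N.factorization p) = N :=
    Nat.ordProj_mul_ordCompl_eq_self N p
  by_cases hdM : d ∣ p ^ N.factorization p
  · refine ⟨_, _, hcop.symm, by rw [mul_comm, hmul], fun h => ?_, fun h => ?_⟩
    · have h1 : N / p ^ N.factorization p = 1 := Nat.Coprime.eq_one_of_dvd hcop.symm (h.trans hdM)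
      rw [h1, mul_one] at hmul
      refine hpp ((isPrimePow_nat_iff _).2 ⟨p, N.factorization p, hp, ?_, hmul⟩)
      refine Nat.pos_of_ne_zero fun h0 => hd1 ?_
      rw [h0, pow_zero] at hdM
      exact Nat.dvd_one.1 hdM
    · exact hd1 (Nat.eq_one_of_dvd_coprimes hcop hdM h)
  · exact ⟨_, _, hcop, hmul.symm, hMd, hdM⟩

lemma mem_zpowers_iff_orderOf_dvd {x y z : G} (hz : IsOfFinOrder z)
    (hx : x ∈ Subgroup.zpowers z) (hy : y ∈ Subgroup.zpowers z) :
    x ∈ Subgroup.zpowers y ↔ orderOf x ∣ orderOf y := by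
  classical
  refine ⟨orderOf_dvd_of_mem_zpowers, fun h => ?_⟩
  rw [hz.mem_zpowers_iff_mem_range_orderOf] at hx hy
  simp only [Finset.mem_image, Finset.mem_range] at hx hy
  obtain ⟨i, -, rfl⟩ := hx
  obtain ⟨j, -, rfl⟩ := hy
  rw [hz.orderOf_pow, hz.orderOf_pow] at h
  have hpos := hz.orderOf_pos
  have hg : (orderOf z).gcd j ∣ (orderOf z).gcd i := by
    have h1 := Nat.div_dvd_div_left (Nat.div_dvd_of_dvd (Nat.gcd_dvd_left (orderOf z) j)) h
    rwa [Nat.div_div_self (Nat.gcd_dvd_left _ _) hpos.ne',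
      Nat.div_div_self (Nat.gcd_dvd_left _ _) hpos.ne'] at h1
  -- By Bézout, `z ^ gcd (orderOf z) j` is a power of `z ^ j`.
  obtain ⟨c, hc⟩ := hg.trans (Nat.gcd_dvd_right _ _)
  refine ⟨(orderOf z).gcdB j * c, ?_⟩
  have hb := Nat.gcd_eq_gcd_ab (orderOf z) j
  have : z ^ ((orderOf z).gcd j : ℤ) = (z ^ j) ^ (orderOf z).gcdB j := by
    rw [hb, zpow_add, zpow_mul, zpow_natCast, pow_orderOf_eq_one, one_zpow, one_mul, zpow_mul,
      zpow_natCast]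
  simp only
  rw [zpow_mul, ← this]
  conv_rhs => rw [hc]
  rw [zpow_natCast, zpow_natCast, pow_mul]

lemma powComparable_iff_orderOf_dvd {x y z : G} (hz : IsOfFinOrder z)
    (hx : x ∈ Subgroup.zpowers z) (hy : y ∈ Subgroup.zpowers z) :
    PowComparable x y ↔ orderOf x ∣ orderOf y ∨ orderOf y ∣ orderOf x := by
  rw [PowComparable, (isOfFinOrder_of_mem_zpowers hz hx).isNonzeroPow_iff,
    (isOfFinOrder_of_mem_zpowers hz hy).isNonzeroPow_iff, mem_zpowers_iff_orderOf_dvd hz hy hx,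
    mem_zpowers_iff_orderOf_dvd hz hx hy, or_comm]

lemma exists_mem_zpowers_orderOf_eq {z : G} (hz : IsOfFinOrder z) {d : ℕ} (hd : d ∣ orderOf z) :
    ∃ s ∈ Subgroup.zpowers z, orderOf s = d :=
  ⟨z ^ (orderOf z / d), Subgroup.npow_mem_zpowers _ _,
    orderOf_pow_orderOf_div hz.orderOf_pos.ne' hd⟩

lemma powComparable_of_orderOf_eq_prime_pow {x y z : G} {p k : ℕ} (hp : p.Prime)
    (hz : orderOf z = p ^ k) (hx : x ∈ Subgroup.zpowers z) (hy : y ∈ Subgroup.zpowers z) :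
    PowComparable x y := by
  have hzf : IsOfFinOrder z := orderOf_pos_iff.1 (hz ▸ pow_pos hp.pos k)
  rw [powComparable_iff_orderOf_dvd hzf hx hy]
  obtain ⟨i, -, hi⟩ := (Nat.dvd_prime_pow hp).1 (hz ▸ orderOf_dvd_of_mem_zpowers hx)
  obtain ⟨j, -, hj⟩ := (Nat.dvd_prime_pow hp).1 (hz ▸ orderOf_dvd_of_mem_zpowers hy)
  rw [hi, hj]
  exact (le_total i j).imp (pow_dvd_pow p) (pow_dvd_pow p)

/-- The set of generators of the cyclic subgroup generated by an element `z` of finite order. -/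
def cyclicGenerators (z : G) : Set G := {w | w ∈ Subgroup.zpowers z ∧ orderOf w = orderOf z}

lemma finite_zpowers_of_isOfFinOrder {z : G} (hz : IsOfFinOrder z) :
    (Subgroup.zpowers z : Set G).Finite := finite_zpowers.2 hz

lemma finite_cyclicGenerators {z : G} (hz : IsOfFinOrder z) : (cyclicGenerators z).Finite :=
  (finite_zpowers_of_isOfFinOrder hz).subset fun _ h => h.1

lemma ncard_cyclicGenerators {z : G} (hz : IsOfFinOrder z) :
    (cyclicGenerators z).ncard = (orderOf z).totient := by
  classical
  have hset : cyclicGenerators z =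
      (((Finset.range (orderOf z)).filter (orderOf z).Coprime).image (z ^ ·) : Finset G) := by
    ext w
    simp only [cyclicGenerators, Set.mem_ofPred_eq, hz.mem_zpowers_iff_mem_range_orderOf,
      Finset.coe_image, Set.mem_image, Finset.mem_coe, Finset.mem_filter, Finset.mem_image,
      Finset.mem_range]
    constructor
    · rintro ⟨⟨i, hi, rfl⟩, ho⟩
      refine ⟨i, ⟨hi, ?_⟩, rfl⟩
      rw [hz.orderOf_pow] at ho
      exact Nat.eq_one_of_dvd_one (by
        have h2 := Nat.div_mul_cancel (Nat.gcd_dvd_left (orderOf z) i)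
        rw [ho] at h2
        exact Nat.dvd_one.2 ((Nat.mul_eq_left hz.orderOf_pos.ne').1 h2))
    · rintro ⟨i, ⟨hi, hc⟩, rfl⟩
      exact ⟨⟨i, hi, rfl⟩, hc.orderOf_pow⟩
  rw [hset, Set.ncard_coe_finset, Finset.card_image_of_injOn, Nat.totient]
  intro i hi j hj hij
  simp only [Finset.coe_filter, Finset.mem_range, Set.mem_ofPred_eq] at hi hj
  exact pow_injOn_Iio_orderOf hi.1 hj.1 hij

lemma powTwin_of_mem_cyclicGenerators {z w : G} (hz : IsOfFinOrder z)
    (hw : w ∈ cyclicGenerators z) : PowTwin z w := by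
  have hwf := isOfFinOrder_of_mem_zpowers hz hw.1
  refine powTwin_of_isNonzeroPow (hz.isNonzeroPow_iff.2 hw.1) (hwf.isNonzeroPow_iff.2 ?_)
  rw [mem_zpowers_iff_orderOf_dvd hz (Subgroup.mem_zpowers z) hw.1, hw.2]

end Cyclic

/-! ### Twins of torsion elements -/

section Twins

variable {G : Type*} [Group G]

/-- An element whose order is not a prime power has no twins among its nontrivial powers except
the generators of the same cyclic subgroup. -/
lemma PowTwin.orderOf_eq_of_not_isPrimePow {a b : G} (h : PowTwin a b) (ha : IsOfFinOrder a)
    (hb : b ∈ Subgroup.zpowers a) (hb1 : b ≠ 1) (hpp : ¬ IsPrimePow (orderOf a)) :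
    orderOf b = orderOf a := by
  by_contra hne
  obtain ⟨M, K, -, hN, hMd, hdM⟩ := exists_coprime_mul_eq_of_not_isPrimePow ha.orderOf_pos.ne' hpp
    (orderOf_dvd_of_mem_zpowers hb) (by rwa [Ne, orderOf_eq_one_iff]) hne
  obtain ⟨s, hs, hso⟩ := exists_mem_zpowers_orderOf_eq ha (Dvd.intro K hN.symm)
  have hsb := (h s).1 (Or.inr (ha.isNonzeroPow_iff.2 hs))
  rw [powComparable_iff_orderOf_dvd ha hs hb, hso] at hsb
  exact hsb.elim hMd hdM

/-- If `orderOf z = M * K` is a nontrivial coprime factorization, then the twins of an element `u`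
of order `M` in `zpowers z` are just the generators of `zpowers u`. -/
lemma PowTwin.mem_cyclicGenerators_of_coprime {z u w : G} {M K : ℕ} (h : PowTwin u w)
    (hz : IsOfFinOrder z) (hzo : orderOf z = M * K) (hMK : M.Coprime K) (hM : M ≠ 1) (hK : K ≠ 1)
    (hu : u ∈ Subgroup.zpowers z) (huo : orderOf u = M) : w ∈ cyclicGenerators u := by
  have hpos := hz.orderOf_pos
  have hM0 : 0 < M := Nat.pos_of_ne_zero (by rintro rfl; rw [zero_mul] at hzo; omega)
  have huf := isOfFinOrder_of_mem_zpowers hz hu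
  have hMdvd : ∀ {c}, c ∣ K → M ∣ c → False := fun hc hMc =>
    hM (Nat.eq_one_of_dvd_coprimes hMK dvd_rfl (hMc.trans hc))
  have hKdvd : ∀ {c}, c ∣ M → K ∣ c → False := fun hc hKc =>
    hK (Nat.eq_one_of_dvd_coprimes hMK (hKc.trans hc) dvd_rfl)
  obtain ⟨v, hv, hvo⟩ := exists_mem_zpowers_orderOf_eq hz (Dvd.intro_left M hzo.symm)
  have hvw : ¬ PowComparable v w := by
    rw [← h v, powComparable_iff_orderOf_dvd hz hv hu, huo, hvo]
    rintro (h' | h')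
    · exact hKdvd dvd_rfl h'
    · exact hMdvd dvd_rfl h'
  have hzw : PowComparable z w := (h z).1 (Or.inl (hz.isNonzeroPow_iff.2 hu))
  have hwf : IsOfFinOrder w := hzw.isOfFinOrder_iff.1 hz
  have hw : w ∈ Subgroup.zpowers z := by
    rcases hzw with h' | h'
    · exact h'.mem_zpowers
    · exact absurd (Or.inr (h'.trans (hz.isNonzeroPow_iff.2 hv))) hvw
  rcases h.powComparable with h' | h'
  · refine ⟨h'.mem_zpowers, ?_⟩
    have hwM : orderOf w ∣ M := huo ▸ orderOf_dvd_of_mem_zpowers h'.mem_zpowers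
    -- If `w` were a proper power of `u`, an element of order `orderOf w * K` would tell them apart.
    obtain ⟨s, hs, hso⟩ := exists_mem_zpowers_orderOf_eq hz
      (show orderOf w * K ∣ orderOf z from hzo ▸ Nat.mul_dvd_mul_right hwM K)
    have hsu : PowComparable s u := (h s).2 (by
      rw [powComparable_iff_orderOf_dvd hz hs hw, hso]
      exact Or.inr (Dvd.intro _ rfl))
    rw [powComparable_iff_orderOf_dvd hz hs hu, hso, huo] at hsu
    rcases hsu with h1 | h1
    · exact absurd (Dvd.intro_left _ rfl) (hKdvd (c := orderOf w * K) h1)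
    · rw [huo]
      exact Nat.dvd_antisymm hwM (hMK.dvd_of_dvd_mul_right h1)
  · have hMw : M ∣ orderOf w := huo ▸ orderOf_dvd_of_mem_zpowers h'.mem_zpowers
    obtain ⟨f, hf⟩ := hMw
    have hfK : f ∣ K := by
      have h1 := orderOf_dvd_of_mem_zpowers hw
      rw [hzo, hf] at h1
      exact Nat.dvd_of_mul_dvd_mul_left hM0 h1
    -- If `w` were a proper root of `u`, an element of order `f` would tell them apart.
    obtain ⟨s, hs, hso⟩ := exists_mem_zpowers_orderOf_eq hz
      (show f ∣ orderOf z from hzo ▸ hfK.mul_left M)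
    have hsu : PowComparable s u := (h s).2 (by
      rw [powComparable_iff_orderOf_dvd hz hs hw, hso, hf]
      exact Or.inl (Dvd.intro_left _ rfl))
    rw [powComparable_iff_orderOf_dvd hz hs hu, hso, huo] at hsu
    rcases hsu with h1 | h1
    · have hf1 : f = 1 := Nat.eq_one_of_dvd_coprimes hMK h1 hfK
      have hwo : orderOf w = orderOf u := by rw [hf, hf1, mul_one, huo]
      exact ⟨(mem_zpowers_iff_orderOf_dvd hz hw hu).2 hwo.dvd, hwo⟩
    · exact (hMdvd hfK h1).elim

/-- If the identity has a nontrivial twin `x`, then `x` generates the set of torsion elements, or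
else all orders of torsion elements are powers of one prime. -/
lemma PowTwin.one_cases {x : G} (h : PowTwin 1 x) (hx : x ≠ 1) :
    (∀ y, IsOfFinOrder y → y ∈ Subgroup.zpowers x) ∨
      ∃ p : ℕ, p.Prime ∧ ∀ y : G, IsOfFinOrder y → ∃ k, orderOf y = p ^ k := by
  have hcmp : ∀ y, IsOfFinOrder y → PowComparable y x := fun y hy =>
    (h y).1 (powComparable_one_iff.2 hy)
  have hxf : IsOfFinOrder x := powComparable_one_iff.1 h.symm.powComparable
  have hxo : orderOf x ≠ 1 := by rwa [Ne, orderOf_eq_one_iff]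
  by_cases hpp : IsPrimePow (orderOf x)
  · right
    obtain ⟨p, k, hp, hk, hpk⟩ := (isPrimePow_nat_iff _).1 hpp
    refine ⟨p, hp, fun y hy => ?_⟩
    rcases hcmp y hy with h' | h'
    · refine ⟨_, Nat.eq_prime_pow_of_unique_prime_dvd hy.orderOf_pos.ne' fun {q} hq hqy => ?_⟩
      obtain ⟨s, hs, hso⟩ := exists_mem_zpowers_orderOf_eq hy hqy
      have hsx := hcmp s (isOfFinOrder_of_mem_zpowers hy hs)
      rw [powComparable_iff_orderOf_dvd hy hs h'.mem_zpowers, hso, ← hpk] at hsx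
      rcases hsx with h1 | h1
      · exact (Nat.prime_dvd_prime_iff_eq hq hp).1 (hq.dvd_of_dvd_pow h1)
      · exact ((Nat.prime_dvd_prime_iff_eq hp hq).1 ((dvd_pow_self p hk.ne').trans h1)).symm
    · obtain ⟨i, -, hi⟩ := (Nat.dvd_prime_pow hp).1 (hpk ▸ orderOf_dvd_of_mem_zpowers h'.mem_zpowers)
      exact ⟨i, hi⟩
  · left
    intro y hy
    rcases hcmp y hy with h' | h'
    · have hxy := h'.mem_zpowers
      by_cases hxy' : orderOf x = orderOf y
      · rw [mem_zpowers_iff_orderOf_dvd hy (Subgroup.mem_zpowers y) hxy, hxy']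
      -- Otherwise some power of `y` is not comparable to `x`.
      · have hpy : ¬ IsPrimePow (orderOf y) := fun hpy =>
          hpp (hpy.dvd (orderOf_dvd_of_mem_zpowers hxy) hxo)
        obtain ⟨M, K, -, hN, hMd, hdM⟩ := exists_coprime_mul_eq_of_not_isPrimePow
          hy.orderOf_pos.ne' hpy (orderOf_dvd_of_mem_zpowers hxy) hxo hxy'
        obtain ⟨s, hs, hso⟩ := exists_mem_zpowers_orderOf_eq hy (Dvd.intro K hN.symm)
        have hsx := hcmp s (isOfFinOrder_of_mem_zpowers hy hs)
        rw [powComparable_iff_orderOf_dvd hy hs hxy, hso] at hsx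
        exact (hsx.elim hMd hdM).elim
    · exact h'.mem_zpowers

/-- If all twins of `t` are nontrivial powers of `t`, they are less than `2 * totient (orderOf t)`
in number: they are generators of `zpowers t` unless `orderOf t` is a prime power, and then already
`zpowers t` has at most `2 * totient (orderOf t)` elements. -/
lemma ncard_powTwin_lt {t : G} (ht : IsOfFinOrder t)
    (hsub : ∀ w, PowTwin t w → w ∈ Subgroup.zpowers t) (h1 : ¬ PowTwin t 1) :
    {w | PowTwin t w}.ncard < 2 * (orderOf t).totient := by
  by_cases hpp : IsPrimePow (orderOf t)
  · obtain ⟨p, k, hp, hk, hpk⟩ := (isPrimePow_nat_iff _).1 hpp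
    have hfin := finite_zpowers_of_isOfFinOrder ht
    have hss : {w | PowTwin t w} ⊂ (Subgroup.zpowers t : Set G) :=
      ⟨hsub, fun hh => h1 (hh (one_mem (Subgroup.zpowers t)))⟩
    have hlt := Set.ncard_lt_ncard hss hfin
    have hcard : (Subgroup.zpowers t : Set G).ncard = orderOf t := by
      rw [← Nat.card_zpowers]; rfl
    rw [hcard] at hlt
    refine hlt.trans_le ?_
    rw [← hpk, Nat.totient_prime_pow hp hk]
    obtain ⟨j, rfl⟩ : ∃ j, k = j + 1 := ⟨k - 1, by omega⟩
    have h2 : p ≤ 2 * (p - 1) := by have := hp.two_le; omega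
    calc p ^ (j + 1) = p ^ j * p := pow_succ _ _
      _ ≤ p ^ j * (2 * (p - 1)) := Nat.mul_le_mul_left _ h2
      _ = 2 * (p ^ (j + 1 - 1) * (p - 1)) := by rw [Nat.add_sub_cancel]; ring
  · have hss : {w | PowTwin t w} ⊆ cyclicGenerators t := fun w hw =>
      ⟨hsub w hw, PowTwin.orderOf_eq_of_not_isPrimePow hw ht (hsub w hw)
        (by rintro rfl; exact h1 hw) hpp⟩
    have hle := Set.ncard_le_ncard hss (finite_cyclicGenerators ht)
    rw [ncard_cyclicGenerators ht] at hle
    have := Nat.totient_pos.2 ht.orderOf_pos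
    omega

end Twins

/-! ### Isomorphisms of power graphs and torsion elements -/

section Torsion

variable {G H : Type*} [Group G] [Group H]

/-- Otherwise `c = φ 1` has infinite order and the twin `c⁻¹`, which gives a nontrivial twin
of `1`. The comparability classes of `1` and `c` correspond, so there are infinitely many torsion
elements in `G`, and their orders are powers of one prime. Then the order on them is a forest, which
excludes the induced path `c ^ 4, c ^ 2, c ^ 6, c ^ 3`. -/
lemma isOfFinOrder_map_one (φ : G ≃ H)
    (hφ : ∀ x y, PowComparable (φ x) (φ y) ↔ PowComparable x y) : IsOfFinOrder (φ 1) := by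
  by_contra hc
  set c := φ 1
  have hfin : ∀ n : ℤ, n ≠ 0 → IsOfFinOrder (φ.symm (c ^ n)) := fun n hn => by
    rw [← powComparable_one_iff, ← hφ, φ.apply_symm_apply]
    exact Or.inr (isNonzeroPow_zpow c hn)
  have htw : PowTwin 1 (φ.symm c⁻¹) := by
    rw [← powTwin_map_iff φ hφ, φ.apply_symm_apply]
    exact powTwin_inv c
  have hne : φ.symm c⁻¹ ≠ 1 := fun h => by
    have h1 : c⁻¹ = c := by rw [← φ.apply_symm_apply c⁻¹, h]
    have h2 : c ^ (-1 : ℤ) = c ^ (1 : ℤ) := by simpa using h1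
    have := zpow_inj_of_infinite hc h2
    omega
  rcases htw.one_cases hne with h | ⟨p, hp, h⟩
  · have hxf : IsOfFinOrder (φ.symm c⁻¹) := by simpa using hfin (-1) (by omega)
    have hinj : Function.Injective fun n : ℕ => φ.symm (c ^ ((n : ℤ) + 1)) := by
      intro n m hnm
      have := zpow_inj_of_infinite hc (φ.symm.injective hnm)
      omega
    refine Set.infinite_range_of_injective hinj
      ((finite_zpowers_of_isOfFinOrder hxf).subset ?_)
    rintro _ ⟨n, rfl⟩
    exact h _ (hfin _ (by omega))
  · have hdown : ∀ n m k : ℤ, n ≠ 0 → m ≠ 0 → k ≠ 0 →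
        PowComparable (φ.symm (c ^ n)) (φ.symm (c ^ m)) →
        PowComparable (φ.symm (c ^ n)) (φ.symm (c ^ k)) →
        ¬ PowComparable (φ.symm (c ^ m)) (φ.symm (c ^ k)) →
        IsNonzeroPow (φ.symm (c ^ m)) (φ.symm (c ^ n)) := by
      intro n m k hn hm hk hnm hnk hmk
      rcases hnm with hnm | hnm
      · obtain ⟨i, hi⟩ := h _ (hfin n hn)
        rcases hnk with hnk | hnk
        · exact absurd (powComparable_of_orderOf_eq_prime_pow hp hi hnm.mem_zpowers
            hnk.mem_zpowers) hmk
        · exact absurd (Or.inr (hnk.trans hnm)) hmk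
      · exact hnm
    have hcmp : ∀ n m : ℤ, PowComparable (φ.symm (c ^ n)) (φ.symm (c ^ m)) ↔
        PowComparable (c ^ n) (c ^ m) := fun n m => powComparable_symm_apply_iff φ hφ _ _
    have hyes : ∀ n m : ℤ, m ≠ 0 → PowComparable (c ^ n) (c ^ (n * m)) := fun n m hm =>
      Or.inl ⟨m, hm, zpow_mul _ _ _⟩
    have hno : ∀ n m : ℤ, ¬ n ∣ m → ¬ m ∣ n → ¬ PowComparable (c ^ n) (c ^ m) :=
      fun n m hnm hmn h' => h'.elim (fun h' => hnm (dvd_of_isNonzeroPow_zpow hc h'))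
        (fun h' => hmn (dvd_of_isNonzeroPow_zpow hc h'))
    have h24 := (hcmp 2 4).2 (hyes 2 2 (by omega))
    have h26 := (hcmp 2 6).2 (hyes 2 3 (by omega))
    have h36 := (hcmp 3 6).2 (hyes 3 2 (by omega))
    have h46 := mt (hcmp 4 6).1 (hno 4 6 (by omega) (by omega))
    have h23 := mt (hcmp 2 3).1 (hno 2 3 (by omega) (by omega))
    have h1 := hdown 2 4 6 (by omega) (by omega) (by omega) h24 h26 h46
    have h2 := hdown 6 2 3 (by omega) (by omega) (by omega) h26.symm h36.symm h23
    exact h46 (Or.inl (h1.trans h2))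

lemma isOfFinOrder_map_iff (φ : G ≃ H)
    (hφ : ∀ x y, PowComparable (φ x) (φ y) ↔ PowComparable x y) (x : G) :
    IsOfFinOrder (φ x) ↔ IsOfFinOrder x := by
  have hforward : IsOfFinOrder x → IsOfFinOrder (φ x) := fun hx =>
    ((hφ x 1).2 (powComparable_one_iff.2 hx)).isOfFinOrder_iff.2 (isOfFinOrder_map_one φ hφ)
  refine ⟨fun hx => ?_, hforward⟩
  have h1 := isOfFinOrder_map_one φ.symm (powComparable_symm_apply_iff φ hφ)
  have h2 := (powComparable_symm_apply_iff φ hφ (φ x) 1).2 (powComparable_one_iff.2 hx)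
  rw [φ.symm_apply_apply] at h2
  exact h2.isOfFinOrder_iff.2 h1

lemma powTwin_one_map_one (φ : G ≃ H)
    (hφ : ∀ x y, PowComparable (φ x) (φ y) ↔ PowComparable x y) : PowTwin 1 (φ 1) := by
  intro w
  obtain ⟨w, rfl⟩ := φ.surjective w
  rw [powComparable_one_iff, hφ, powComparable_one_iff, isOfFinOrder_map_iff φ hφ]

lemma ncard_powTwin_map (φ : G ≃ H)
    (hφ : ∀ x y, PowComparable (φ x) (φ y) ↔ PowComparable x y) (x : G) :
    {w | PowTwin (φ x) w}.ncard = {w | PowTwin x w}.ncard := by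
  have : {w | PowTwin (φ x) w} = φ '' {w | PowTwin x w} := by
    ext w
    obtain ⟨w, rfl⟩ := φ.surjective w
    simp [powTwin_map_iff φ hφ]
  rw [this, Set.ncard_image_of_injective _ φ.injective]

/-- The number of generators of `zpowers (φ u)` is at most that of `zpowers u`, since the latter are
all the twins of `u`. -/
lemma totient_orderOf_map_le (φ : G ≃ H)
    (hφ : ∀ x y, PowComparable (φ x) (φ y) ↔ PowComparable x y) {z u : G} {M K : ℕ}
    (hz : IsOfFinOrder z) (hzo : orderOf z = M * K) (hMK : M.Coprime K) (hM : M ≠ 1) (hK : K ≠ 1)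
    (hu : u ∈ Subgroup.zpowers z) (huo : orderOf u = M) :
    (orderOf (φ u)).totient ≤ M.totient := by
  have huf := isOfFinOrder_of_mem_zpowers hz hu
  have hsub : {w | PowTwin u w} ⊆ cyclicGenerators u := fun w hw =>
    PowTwin.mem_cyclicGenerators_of_coprime hw hz hzo hMK hM hK hu huo
  have hfin : {w | PowTwin (φ u) w}.Finite := by
    refine (((finite_cyclicGenerators huf).subset hsub).image φ).subset fun w hw => ?_
    obtain ⟨w, rfl⟩ := φ.surjective w
    exact ⟨w, (powTwin_map_iff φ hφ).1 hw, rfl⟩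
  have hfu := (isOfFinOrder_map_iff φ hφ u).2 huf
  rw [← ncard_cyclicGenerators hfu]
  have hsub' : cyclicGenerators (φ u) ⊆ {w | PowTwin (φ u) w} := fun w hw =>
    powTwin_of_mem_cyclicGenerators hfu hw
  refine (Set.ncard_le_ncard hsub' hfin).trans ?_
  rw [ncard_powTwin_map φ hφ, ← huo, ← ncard_cyclicGenerators huf]
  exact Set.ncard_le_ncard hsub (finite_cyclicGenerators huf)

end Torsion

/-! ### Common roots of torsion elements -/

section CommonRoots

variable {G H : Type*} [Group G] [Group H]

/-- An element comparable to two incomparable elements is below both or above both. -/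
lemma mem_zpowers_or_mem_zpowers {u v w : G} (huv : ¬ PowComparable u v) (hu : PowComparable w u)
    (hv : PowComparable w v) :
    (w ∈ Subgroup.zpowers u ∧ w ∈ Subgroup.zpowers v) ∨
      (u ∈ Subgroup.zpowers w ∧ v ∈ Subgroup.zpowers w) := by
  rcases hu with hu | hu <;> rcases hv with hv | hv
  · exact Or.inr ⟨hu.mem_zpowers, hv.mem_zpowers⟩
  · exact absurd (Or.inr (hv.trans hu)) huv
  · exact absurd (Or.inl (hu.trans hv)) huv
  · exact Or.inl ⟨hu.mem_zpowers, hv.mem_zpowers⟩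

/-- Suppose that all torsion elements have orders that are powers of one prime. Then all twins of a
common power `w` of incomparable torsion elements `u` and `v` are common powers of them as well.
These form a proper subgroup of `zpowers u`, whose order is at most `totient (orderOf u)`. -/
lemma ncard_powTwin_le_of_prime_pow {u v w : G} {p : ℕ} (hp : p.Prime)
    (hG : ∀ y : G, IsOfFinOrder y → ∃ k, orderOf y = p ^ k) (hu : IsOfFinOrder u)
    (huv : ¬ PowComparable u v)
    (hwu : w ∈ Subgroup.zpowers u) (hwv : IsNonzeroPow v w) :
    {s | PowTwin w s}.Finite ∧ {s | PowTwin w s}.ncard ≤ (orderOf u).totient := by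
  have hwu' := hu.isNonzeroPow_iff.2 hwu
  have hsub : {s | PowTwin w s} ⊆ (Subgroup.zpowers u ⊓ Subgroup.zpowers v : Subgroup G) := by
    intro s hs
    have hsu : PowComparable s u := ((hs u).1 (Or.inl hwu')).symm
    rcases mem_zpowers_or_mem_zpowers huv hsu ((hs v).1 (Or.inl hwv)).symm with h | h
    · exact h
    · obtain ⟨k, hk⟩ := hG s (hsu.isOfFinOrder_iff.2 hu)
      exact absurd (powComparable_of_orderOf_eq_prime_pow hp hk h.1 h.2) huv
  have hfinu := finite_zpowers_of_isOfFinOrder hu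
  have hfin : ((Subgroup.zpowers u ⊓ Subgroup.zpowers v : Subgroup G) : Set G).Finite :=
    hfinu.subset fun _ h => h.1
  refine ⟨hfin.subset hsub, (Set.ncard_le_ncard hsub hfin).trans ?_⟩
  obtain ⟨k, hk⟩ := hG u hu
  have hcardu : ((Subgroup.zpowers u : Subgroup G) : Set G).ncard = p ^ k := by
    rw [← hk, ← Nat.card_zpowers]; rfl
  have hdvd : ((Subgroup.zpowers u ⊓ Subgroup.zpowers v : Subgroup G) : Set G).ncard ∣ p ^ k := by
    rw [← hcardu]
    exact Subgroup.card_dvd_of_le inf_le_left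
  obtain ⟨i, hik, hi⟩ := (Nat.dvd_prime_pow hp).1 hdvd
  have hlt : ((Subgroup.zpowers u ⊓ Subgroup.zpowers v : Subgroup G) : Set G).ncard < p ^ k := by
    rw [← hcardu]
    refine Set.ncard_lt_ncard ⟨fun _ h => h.1, fun hle => huv (Or.inr ?_)⟩ hfinu
    have huv' : u ∈ Subgroup.zpowers v := (hle (Subgroup.mem_zpowers u)).2
    have hv : IsOfFinOrder v := by
      rw [← hwv.isOfFinOrder_iff, hwu'.isOfFinOrder_iff]; exact hu
    exact hv.isNonzeroPow_iff.2 huv'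
  rw [hi] at hlt ⊢
  have hik' : i < k := (Nat.pow_lt_pow_iff_right hp.one_lt).1 hlt
  rw [hk, Nat.totient_prime_pow hp (by omega)]
  calc p ^ i ≤ p ^ (k - 1) := Nat.pow_le_pow_right hp.pos (by omega)
    _ ≤ p ^ (k - 1) * (p - 1) := Nat.le_mul_of_pos_right _ (by have := hp.two_le; omega)

/-- If `w ≠ 1` is a common power of incomparable torsion elements `u` and `v` and not a twin of `1`,
then its twins are powers of the largest one among them, which is a common power of `u` and `v`. -/
lemma exists_ncard_powTwin_lt {u v w : G} (hu : IsOfFinOrder u) (huv : ¬ PowComparable u v)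
    (hwu : w ∈ Subgroup.zpowers u) (hwv : IsNonzeroPow v w) (hw : ¬ PowTwin w 1) :
    ∃ t ∈ Subgroup.zpowers u, t ∈ Subgroup.zpowers v ∧ {s | PowTwin w s}.Finite ∧
      {s | PowTwin w s}.ncard < 2 * (orderOf t).totient := by
  have hwu' := hu.isNonzeroPow_iff.2 hwu
  have hwf : IsOfFinOrder w := hwu'.isOfFinOrder_iff.2 hu
  have hw1 : w ≠ 1 := by rintro rfl; exact hw (.refl 1)
  have hsub : ∀ s, PowTwin w s → s ∈ Subgroup.zpowers u ∧ s ∈ Subgroup.zpowers v := by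
    intro s hs
    have hsu : PowComparable s u := ((hs u).1 (Or.inl hwu')).symm
    have hsf := hsu.isOfFinOrder_iff.2 hu
    rcases mem_zpowers_or_mem_zpowers huv hsu ((hs v).1 (Or.inl hwv)).symm with h | h
    · exact h
    -- A twin `s` above `u` and `v` would not have prime power order, so `w` would generate
    -- `zpowers s`, and `u` would be a power of `v`.
    · exfalso
      have hpp : ¬ IsPrimePow (orderOf s) := fun hpp => by
        obtain ⟨p, k, hp, -, hpk⟩ := (isPrimePow_nat_iff _).1 hpp
        exact huv (powComparable_of_orderOf_eq_prime_pow hp hpk.symm h.1 h.2)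
      have hws : w ∈ Subgroup.zpowers s := Subgroup.zpowers_le.2 h.1 hwu
      have ho := hs.symm.orderOf_eq_of_not_isPrimePow hsf hws hw1 hpp
      have hsw : s ∈ Subgroup.zpowers w := by
        rw [mem_zpowers_iff_orderOf_dvd hsf (Subgroup.mem_zpowers s) hws, ho]
      have huw := hwf.isNonzeroPow_iff.2 (Subgroup.zpowers_le.2 hsw h.1)
      exact huv (Or.inr (hwv.trans huw))
  have hfin : {s | PowTwin w s}.Finite :=
    (finite_zpowers_of_isOfFinOrder hu).subset fun s hs => (hsub s hs).1
  obtain ⟨t, ht, hmax⟩ := Set.exists_max_image _ orderOf hfin ⟨w, .refl w⟩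
  have htf := isOfFinOrder_of_mem_zpowers hu (hsub t ht).1
  have heq : {s | PowTwin w s} = {s | PowTwin t s} :=
    Set.ext fun s => ⟨fun hs => PowTwin.trans (PowTwin.symm ht) hs, fun hs => PowTwin.trans ht hs⟩
  refine ⟨t, (hsub t ht).1, (hsub t ht).2, hfin, ?_⟩
  rw [heq]
  refine ncard_powTwin_lt htf (fun s hs => ?_) fun h => hw (PowTwin.trans ht h)
  rcases hs.powComparable with h | h
  · exact h.mem_zpowers
  · have hsf := h.isOfFinOrder_iff.1 htf
    have hst := hmax s (PowTwin.trans ht hs)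
    have hts := orderOf_dvd_of_mem_zpowers h.mem_zpowers
    have ho := Nat.le_antisymm (Nat.le_of_dvd hsf.orderOf_pos hts) hst
    rw [mem_zpowers_iff_orderOf_dvd hsf (Subgroup.mem_zpowers s) h.mem_zpowers, ho]

/-- The order cannot be reversed at a torsion element `z` with `orderOf z = M * K` a nontrivial
coprime factorization: powers `u` and `v` of orders `M` and `K` would be mapped to roots of `φ z`,
so `φ z` would be too small an element to have as many twins as `z`. The case that a single element
of `H` generates all torsion elements is excluded: there any two of them have a common root. -/
lemma false_of_isNonzeroPow_map (φ : G ≃ H)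
    (hφ : ∀ x y, PowComparable (φ x) (φ y) ↔ PowComparable x y) {z u v : G} {M K : ℕ}
    (hz : IsOfFinOrder z) (hzo : orderOf z = M * K) (hMK : M.Coprime K) (hM : M ≠ 1) (hK : K ≠ 1)
    (hu : u ∈ Subgroup.zpowers z) (huo : orderOf u = M)
    (hv : v ∈ Subgroup.zpowers z) (hvo : orderOf v = K)
    (huz : IsNonzeroPow (φ u) (φ z)) (hvz : IsNonzeroPow (φ v) (φ z))
    (hH : ∀ x : H, ¬ ∀ y, IsOfFinOrder y → y ∈ Subgroup.zpowers x) : False := by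
  have hfu := (isOfFinOrder_map_iff φ hφ u).2 (isOfFinOrder_of_mem_zpowers hz hu)
  have hfv := (isOfFinOrder_map_iff φ hφ v).2 (isOfFinOrder_of_mem_zpowers hz hv)
  have hM0 : M ≠ 0 := by rintro rfl; have := hz.orderOf_pos; rw [hzo, zero_mul] at this; omega
  have hK0 : K ≠ 0 := by rintro rfl; have := hz.orderOf_pos; rw [hzo, mul_zero] at this; omega
  have huv : ¬ PowComparable (φ u) (φ v) := by
    rw [hφ, powComparable_iff_orderOf_dvd hz hu hv, huo, hvo]
    rintro (h | h)
    · exact hM (Nat.eq_one_of_dvd_coprimes hMK dvd_rfl h)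
    · exact hK (Nat.eq_one_of_dvd_coprimes hMK h dvd_rfl)
  have hleM := totient_orderOf_map_le φ hφ hz hzo hMK hM hK hu huo
  have hleK := totient_orderOf_map_le φ hφ hz (hzo.trans (mul_comm M K)) hMK.symm hK hM hv hvo
  have hpos : ∀ {n : ℕ}, n ≠ 0 → 1 ≤ n.totient := fun hn =>
    Nat.totient_pos.2 (Nat.pos_of_ne_zero hn)
  have hM1 := hpos hM0
  have hK1 := hpos hK0
  have hle : {s | PowTwin (φ z) s}.Finite →
      M.totient * K.totient ≤ {s | PowTwin (φ z) s}.ncard := fun hfin => by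
    have hfin' : {s | PowTwin z s}.Finite := by
      refine (hfin.preimage φ.injective.injOn).subset fun s hs => ?_
      exact (powTwin_map_iff φ hφ).2 hs
    rw [ncard_powTwin_map φ hφ, ← Nat.totient_mul hMK, ← hzo, ← ncard_cyclicGenerators hz]
    have hsub : cyclicGenerators z ⊆ {s | PowTwin z s} := fun w hw =>
      powTwin_of_mem_cyclicGenerators hz hw
    exact Set.ncard_le_ncard hsub hfin'
  -- Two coprime numbers larger than `1` do not both have totient `1`.
  have hne : ¬ (M.totient = 1 ∧ K.totient = 1) := by
    rw [Nat.totient_eq_one_iff, Nat.totient_eq_one_iff]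
    rintro ⟨h1, h2⟩
    have h1 := h1.resolve_left hM
    have h2 := h2.resolve_left hK
    rw [h1, h2] at hMK
    norm_num at hMK
  by_cases htw : ∃ h : H, h ≠ 1 ∧ PowTwin 1 h
  · obtain ⟨h, h1, hh⟩ := htw
    rcases hh.one_cases h1 with hcyc | ⟨p, hp, hpow⟩
    · exact hH h hcyc
    · obtain ⟨hfin, hub⟩ :=
        ncard_powTwin_le_of_prime_pow hp hpow hfu huv huz.mem_zpowers hvz
      obtain ⟨-, hvb⟩ := ncard_powTwin_le_of_prime_pow hp hpow hfv (fun h => huv h.symm)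
        hvz.mem_zpowers huz
      have hle := hle hfin
      refine hne ⟨?_, ?_⟩ <;> nlinarith
  · have hz1 : ¬ PowTwin (φ z) 1 := by
      intro h
      have e1 : φ z = 1 := by
        by_contra hne1
        exact htw ⟨_, hne1, h.symm⟩
      have e2 : φ 1 = 1 := by
        by_contra hne1
        exact htw ⟨_, hne1, powTwin_one_map_one φ hφ⟩
      have e3 : z = 1 := φ.injective (e1.trans e2.symm)
      rw [e3, orderOf_one] at hzo
      exact hM (Nat.eq_one_of_mul_eq_one_right hzo.symm)
    obtain ⟨t, htu, htv, hfin, hlt⟩ :=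
      exists_ncard_powTwin_lt hfu huv huz.mem_zpowers hvz hz1
    have hle := hle hfin
    have htM := (Nat.le_of_dvd (hpos hfu.orderOf_pos.ne')
      (Nat.totient_dvd_of_dvd (orderOf_dvd_of_mem_zpowers htu))).trans hleM
    have htK := (Nat.le_of_dvd (hpos hfv.orderOf_pos.ne')
      (Nat.totient_dvd_of_dvd (orderOf_dvd_of_mem_zpowers htv))).trans hleK
    have hsq := Nat.mul_le_mul htM htK
    have ht1 : (orderOf t).totient < 2 := by
      by_contra hge
      nlinarith
    have hlt2 : M.totient * K.totient < 2 := by omega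
    refine hne ⟨?_, ?_⟩ <;> nlinarith

lemma haveCommonRoot_map_of_isOfFinOrder (φ : G ≃ H)
    (hφ : ∀ x y, PowComparable (φ x) (φ y) ↔ PowComparable x y) {x y : G} (hx : IsOfFinOrder x)
    (hy : IsOfFinOrder y) (h : HaveCommonRoot x y) : HaveCommonRoot (φ x) (φ y) := by
  by_contra hno
  have hxy : ¬ PowComparable x y := fun hxy => hno ((hφ _ _).2 hxy).haveCommonRoot
  obtain ⟨z, hxz, hyz⟩ := h
  have hx1 : x ≠ 1 := by rintro rfl; exact hxy (powComparable_one_iff.2 hy).symm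
  have hz : IsOfFinOrder z := by
    obtain ⟨n, rfl⟩ := hxz
    have hn : n ≠ 0 := by rintro rfl; exact hx1 (zpow_zero z)
    exact (isNonzeroPow_zpow z hn).isOfFinOrder_iff.1 hx
  have hcmp : ∀ w ∈ Subgroup.zpowers z, PowComparable (φ z) (φ w) := fun w hw =>
    (hφ _ _).2 (Or.inl (hz.isNonzeroPow_iff.2 hw))
  -- Incomparable powers of `z` are mapped to the same side of `φ z`.
  have hside : ∀ a b, b ∈ Subgroup.zpowers z → ¬ PowComparable a b →
      IsNonzeroPow (φ a) (φ z) → IsNonzeroPow (φ b) (φ z) := fun a b hb hab ha =>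
    (hcmp b hb).resolve_left fun h => hab ((hφ _ _).1 (Or.inl (ha.trans h)))
  have hxs : IsNonzeroPow (φ x) (φ z) := by
    rcases hcmp x hxz with h1 | h1
    · rcases hcmp y hyz with h2 | h2
      · exact absurd ⟨φ z, h1.mem_zpowers, h2.mem_zpowers⟩ hno
      · exact hside y x hxz (fun h => hxy h.symm) h2
    · exact h1
  have hpp : ¬ IsPrimePow (orderOf z) := fun hpp => by
    obtain ⟨p, k, hp, -, hpk⟩ := (isPrimePow_nat_iff _).1 hpp
    exact hxy (powComparable_of_orderOf_eq_prime_pow hp hpk.symm hxz hyz)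
  have hxo : orderOf x ≠ orderOf z := fun ho => hxy (by
    rw [powComparable_iff_orderOf_dvd hz hxz hyz, ho]
    exact Or.inr (orderOf_dvd_of_mem_zpowers hyz))
  obtain ⟨M, K, hMK, hN, hMd, hdM⟩ := exists_coprime_mul_eq_of_not_isPrimePow hz.orderOf_pos.ne'
    hpp (orderOf_dvd_of_mem_zpowers hxz) (by rwa [Ne, orderOf_eq_one_iff]) hxo
  obtain ⟨u, hu, huo⟩ := exists_mem_zpowers_orderOf_eq hz (Dvd.intro K hN.symm)
  obtain ⟨v, hv, hvo⟩ := exists_mem_zpowers_orderOf_eq hz (Dvd.intro_left M hN.symm)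
  have hM : M ≠ 1 := by rintro rfl; exact hMd (one_dvd _)
  have hK : K ≠ 1 := by
    rintro rfl
    rw [mul_one] at hN
    exact hdM (hN ▸ orderOf_dvd_of_mem_zpowers hxz)
  have hus : IsNonzeroPow (φ u) (φ z) := by
    refine hside x u hu ?_ hxs
    rw [powComparable_iff_orderOf_dvd hz hxz hu, huo]
    exact fun h => h.elim hdM hMd
  have hvs : IsNonzeroPow (φ v) (φ z) := by
    refine hside u v hv ?_ hus
    rw [powComparable_iff_orderOf_dvd hz hu hv, huo, hvo]
    rintro (h | h)
    · exact hM (Nat.eq_one_of_dvd_coprimes hMK dvd_rfl h)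
    · exact hK (Nat.eq_one_of_dvd_coprimes hMK h dvd_rfl)
  refine false_of_isNonzeroPow_map φ hφ hz hN hMK hM hK hu huo hv hvo hus hvs fun h hcyc => hno ?_
  exact ⟨h, hcyc _ ((isOfFinOrder_map_iff φ hφ x).2 hx), hcyc _ ((isOfFinOrder_map_iff φ hφ y).2 hy)⟩

end CommonRoots

/-! ### Isomorphism of enhanced power graphs -/

section Graphs

variable {G H : Type*} [Group G] [Group H]

lemma powerGraph_adj_iff {x y : G} : (powerGraph G).Adj x y ↔ x ≠ y ∧ PowComparable x y := by
  simp only [powerGraph, PowComparable, IsNonzeroPow, and_or_left, exists_or]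

lemma enhancedPowerGraph_adj_iff {x y : G} :
    (enhancedPowerGraph G).Adj x y ↔ x ≠ y ∧ HaveCommonRoot x y := by
  simp only [enhancedPowerGraph, HaveCommonRoot, Subgroup.mem_zpowers_iff]
  refine and_congr_right fun _ => exists_congr fun z => ?_
  constructor
  · rintro ⟨n, m, rfl, rfl⟩
    exact ⟨⟨n, rfl⟩, m, rfl⟩
  · rintro ⟨⟨n, rfl⟩, m, rfl⟩
    exact ⟨n, m, rfl, rfl⟩

lemma powComparable_map_iff_of_iso (φ : powerGraph G ≃g powerGraph H) (x y : G) :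
    PowComparable (φ.toEquiv x) (φ.toEquiv y) ↔ PowComparable x y := by
  by_cases hxy : x = y
  · subst hxy
    exact ⟨fun _ => .refl _, fun _ => .refl _⟩
  · have h := φ.map_adj_iff (v := x) (w := y)
    rw [powerGraph_adj_iff, powerGraph_adj_iff, and_iff_right hxy,
      and_iff_right (φ.injective.ne hxy)] at h
    exact h

/-- For elements that are both torsion or both of infinite order, `φ` preserves and reflects the
existence of a common root. -/
lemma haveCommonRoot_map_iff (φ : G ≃ H)
    (hφ : ∀ x y, PowComparable (φ x) (φ y) ↔ PowComparable x y) {x y : G}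
    (hxy : IsOfFinOrder x ↔ IsOfFinOrder y) :
    HaveCommonRoot (φ x) (φ y) ↔ HaveCommonRoot x y := by
  have hT := isOfFinOrder_map_iff φ hφ
  have hφ' := powComparable_symm_apply_iff φ hφ
  by_cases hx : IsOfFinOrder x
  · refine ⟨fun h => ?_, haveCommonRoot_map_of_isOfFinOrder φ hφ hx (hxy.1 hx)⟩
    simpa using haveCommonRoot_map_of_isOfFinOrder φ.symm hφ' ((hT x).2 hx) ((hT y).2 (hxy.1 hx)) h
  · have hy : ¬ IsOfFinOrder y := fun hy => hx (hxy.2 hy)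
    refine ⟨fun h => ?_, haveCommonRoot_map_of_not_isOfFinOrder φ hφ hT hx hy⟩
    simpa using haveCommonRoot_map_of_not_isOfFinOrder φ.symm hφ' (isOfFinOrder_map_iff _ hφ')
      (mt (hT x).1 hx) (mt (hT y).1 hy) h

/-- An element which has a common root with every torsion element, such as `φ 1` or `φ.symm 1`,
may be exchanged with the identity: this makes `φ` map the identity to the identity, the only
torsion element which has a common root with elements of infinite order. -/
lemma haveCommonRoot_trans_swap_iff [DecidableEq H] (φ : G ≃ H)
    (hφ : ∀ x y, PowComparable (φ x) (φ y) ↔ PowComparable x y) (x y : G) :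
    HaveCommonRoot (φ.trans (Equiv.swap (φ 1) 1) x) (φ.trans (Equiv.swap (φ 1) 1) y) ↔
      HaveCommonRoot x y := by
  have hT := isOfFinOrder_map_iff φ hφ
  set ψ := φ.trans (Equiv.swap (φ 1) 1) with hψ
  have hψ1 : ψ 1 = 1 := by simp [hψ]
  have hφ1 : IsOfFinOrder (φ 1) := (hT 1).2 IsOfFinOrder.one
  have hother : ∀ x, x ≠ 1 → φ x ≠ 1 → ψ x = φ x := fun x hx hx' => by
    rw [hψ, Equiv.trans_apply, Equiv.swap_apply_of_ne_of_ne (φ.injective.ne hx) hx']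
  have hpre : ∀ x, φ x = 1 → ψ x = φ 1 := fun x hx => by
    rw [hψ, Equiv.trans_apply, hx, Equiv.swap_apply_right]
  have hinf : ∀ x, ¬ IsOfFinOrder x → ψ x = φ x := fun x hx =>
    hother x (by rintro rfl; exact hx IsOfFinOrder.one)
      (fun h => hx ((hT x).1 (h ▸ IsOfFinOrder.one)))
  have hψT : ∀ x, IsOfFinOrder (ψ x) ↔ IsOfFinOrder x := by
    intro x
    by_cases hx : x = 1
    · rw [hx, hψ1]; exact iff_of_true IsOfFinOrder.one IsOfFinOrder.one
    by_cases hx' : φ x = 1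
    · rw [hpre x hx', ← hT x, hx']; exact iff_of_true hφ1 IsOfFinOrder.one
    · rw [hother x hx hx', hT]
  have hmixed : ∀ x y, IsOfFinOrder x → ¬ IsOfFinOrder y →
      (HaveCommonRoot (ψ x) (ψ y) ↔ HaveCommonRoot x y) := by
    intro x y hx hy
    constructor
    · intro h
      have h1 := h.eq_one ((hψT x).2 hx) (mt (hψT y).1 hy)
      rw [ψ.injective (h1.trans hψ1.symm)]
      exact haveCommonRoot_one_left y
    · intro h
      rw [h.eq_one hx hy, hψ1]
      exact haveCommonRoot_one_left _
  have hroot : ∀ a : H, IsOfFinOrder a → HaveCommonRoot (φ 1) a := by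
    intro a ha
    obtain ⟨a, rfl⟩ := φ.surjective a
    rw [haveCommonRoot_map_iff φ hφ (iff_of_true IsOfFinOrder.one ((hT a).1 ha))]
    exact haveCommonRoot_one_left a
  have hroot' : ∀ x y, φ x = 1 → IsOfFinOrder y → HaveCommonRoot x y := by
    intro x y hx hy
    have hxf : IsOfFinOrder x := (hT x).1 (hx ▸ IsOfFinOrder.one)
    rw [← haveCommonRoot_map_iff φ hφ (iff_of_true hxf hy), hx]
    exact haveCommonRoot_one_left _
  have hspecial : ∀ x y, IsOfFinOrder y → (x = 1 ∨ φ x = 1) →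
      HaveCommonRoot (ψ x) (ψ y) ∧ HaveCommonRoot x y := by
    rintro x y hy (rfl | hx)
    · rw [hψ1]
      exact ⟨haveCommonRoot_one_left _, haveCommonRoot_one_left _⟩
    · rw [hpre x hx]
      exact ⟨hroot _ ((hψT y).2 hy), hroot' x y hx hy⟩
  by_cases hx : IsOfFinOrder x <;> by_cases hy : IsOfFinOrder y
  · by_cases hx1 : x = 1 ∨ φ x = 1
    · exact iff_of_true (hspecial x y hy hx1).1 (hspecial x y hy hx1).2
    by_cases hy1 : y = 1 ∨ φ y = 1
    · exact iff_of_true (hspecial y x hx hy1).1.symm (hspecial y x hx hy1).2.symm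
    · push Not at hx1 hy1
      rw [hother x hx1.1 hx1.2, hother y hy1.1 hy1.2]
      exact haveCommonRoot_map_iff φ hφ (iff_of_true hx hy)
  · exact hmixed x y hx hy
  · exact ⟨fun h => ((hmixed y x hy hx).1 h.symm).symm, fun h => ((hmixed y x hy hx).2 h.symm).symm⟩
  · rw [hinf x hx, hinf y hy]
    exact haveCommonRoot_map_iff φ hφ (iff_of_false hx hy)

end Graphs

theorem mainTheorem1 {G H : Type*} [Group G] [Group H]
    (h : Nonempty (powerGraph G ≃g powerGraph H)) :
    Nonempty (enhancedPowerGraph G ≃g enhancedPowerGraph H) := by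
  classical
  obtain ⟨φ⟩ := h
  have hφ := powComparable_map_iff_of_iso φ
  refine ⟨φ.toEquiv.trans (Equiv.swap (φ.toEquiv 1) 1), ?_⟩
  intro x y
  rw [enhancedPowerGraph_adj_iff, enhancedPowerGraph_adj_iff,
    haveCommonRoot_trans_swap_iff φ.toEquiv hφ, (Equiv.injective _).ne_iff]
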